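/- For $g\ge 0$ let $\pi_g=\langle a_1,b_1,\dots,a_g,b_g \mid [a_1,b_1]\cdots[a_g,b_g]\rangle$ be the fundamental group of the closed orientable surface of genus $g$. A group is finitely presentable if it is the quotient of a free group of finite rank by the normal closure of a finite set. A finite presentation of a group $G$ is an epimorphism $a:A\to G$ where $A$ is a finitely presentable group and $\operatorname{Ker} a$ is the normal closure of a finitely generated subgroup of $A$. Cohomology of groups is taken with coefficients in the trivial module $\mathbb{R}$. Let $\Gamma$ be a finitely presentable abelian group such that $H^2(\Gamma;\mathbb{R})\neq 0$. Then there exist $g\ge 0$ and a finite presentation $p_\Gamma:\pi_g\to\Gamma$ such that the induced map $$p_\Gamma^*: H^2(\Gamma;\mathbb{R})\to H^2(\pi_g;\mathbb{R})$$ is non-zero. -/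

import Mathlib

open CategoryTheory

/-- The word `[a₁, b₁] ⋯ [a_g, b_g]` in the free group on `a₁, …, a_g, b₁, …, b_g`, where
`a_i` is `Sum.inl i`, `b_i` is `Sum.inr i` and `[a, b] = a * b * a⁻¹ * b⁻¹`. -/
def surfaceRelator (g : ℕ) : FreeGroup (Fin g ⊕ Fin g) :=
  (List.ofFn fun i : Fin g =>
    FreeGroup.of (Sum.inl i) * FreeGroup.of (Sum.inr i) *
      (FreeGroup.of (Sum.inl i))⁻¹ * (FreeGroup.of (Sum.inr i))⁻¹).prod

/-- The surface group `π_g = ⟨a₁, b₁, …, a_g, b_g ∣ [a₁, b₁] ⋯ [a_g, b_g]⟩`, the fundamental group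
of the closed orientable surface of genus `g`. -/
abbrev SurfaceGroup (g : ℕ) : Type :=
  PresentedGroup ({surfaceRelator g} : Set (FreeGroup (Fin g ⊕ Fin g)))

/-- A finite presentation of a group `G`: an epimorphism `a : A → G` from a finitely presentable
group `A` such that `ker a` is the normal closure of a finitely generated subgroup of `A`. -/
structure IsFinitePresentation {A G : Type*} [Group A] [Group G] (a : A →* G) : Prop where
  finitelyPresented : Group.IsFinitelyPresented A
  surjective : Function.Surjective a
  ker_eq : ∃ K : Subgroup A, K.FG ∧ Subgroup.normalClosure (K : Set A) = a.ker

/-- `Hⁿ(G; ℝ)`: group cohomology with coefficients in the trivial `G`-module `ℝ`. -/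
noncomputable abbrev realCohomology (G : Type) [Group G] (n : ℕ) : ModuleCat ℝ :=
  groupCohomology (Rep.trivial ℝ G ℝ) n

/-- The map `f^* : Hⁿ(H; ℝ) → Hⁿ(G; ℝ)` induced by a group homomorphism `f : G → H` and the
identity of the coefficients. -/
noncomputable def realCohomologyMap {G H : Type} [Group G] [Group H] (f : G →* H) (n : ℕ) :
    realCohomology H n ⟶ realCohomology G n :=
  groupCohomology.map (A := Rep.trivial ℝ H ℝ) (B := Rep.trivial ℝ G ℝ) f
    (𝟙 (Rep.trivial ℝ G ℝ)) n

/-!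
A class in `H²(Γ; M)` is represented by a factor set `f`. If `f` is symmetric, the central extension
of `Γ` by `M` which it defines is abelian, so it splits when `M` is divisible, and the class
vanishes. Hence a nonzero class has `f (x, y) ≠ f (y, x)` for some `x` and `y`. Map a surface group
onto `Γ` by sending `a₀, b₀` to `x, y`, the other `a_i` to generators of `Γ` and the other `b_i` to
`1`. If the class pulled back to zero, this map would lift to the central extension, where the image
of `[a₀, b₀] ⋯ [a_n, b_n] = 1` is the central element
`∑ i, (f (p a_i, p b_i) - f (p b_i, p a_i)) = f (x, y) - f (y, x)`, a contradiction.

The map is a finite presentation because a group presented by finitely many relators in one finite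
generating set is so presented in every other one.
-/

section FinitelyPresented

variable {A G : Type*} [Group A] [Group G]

theorem fg_of_isFinitelyPresented (G : Type*) [Group G] [hG : Group.IsFinitelyPresented G] :
    Group.FG G := by
  obtain ⟨n, φ, hφ, -⟩ := hG.out
  exact Group.fg_of_surjective hφ

theorem isFinitelyNormallyGenerated_ker_of_comp_eq_id [Group.FG A] (r : A →* G) (s : G →* A)
    (hrs : r.comp s = MonoidHom.id G) : r.ker.IsFinitelyNormallyGenerated := by
  obtain ⟨S, hS, hSfin⟩ := Group.fg_iff.1 ‹Group.FG A›
  have hr (x : G) : r (s x) = x := DFunLike.congr_fun hrs x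
  let T : Set A := (fun x => x / s (r x)) '' S
  have hT : Subgroup.normalClosure T ≤ r.ker :=
    Subgroup.normalClosure_le_normal <| by
      rintro _ ⟨x, -, rfl⟩
      simp [MonoidHom.mem_ker, hr]
  refine ⟨T, hSfin.image _, hT.antisymm fun x hx => ?_⟩
  let q := QuotientGroup.mk' (Subgroup.normalClosure T)
  have hq : q = q.comp (s.comp r) := MonoidHom.eq_of_eqOn_dense hS fun x hx =>
    QuotientGroup.eq_iff_div_mem.2 (Subgroup.subset_normalClosure ⟨x, hx, rfl⟩)
  have hqx : q x = 1 := by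
    rw [hq, MonoidHom.comp_apply, MonoidHom.comp_apply, MonoidHom.mem_ker.1 hx, map_one, map_one]
  exact (QuotientGroup.eq_one_iff x).1 hqx

theorem exists_freeGroup_hom_comp_eq {α : Type*} {a : A →* G} (ha : Function.Surjective a)
    (φ : FreeGroup α →* G) : ∃ ψ : FreeGroup α →* A, a.comp ψ = φ := by
  choose w hw using fun i => ha (φ (FreeGroup.of i))
  exact ⟨FreeGroup.lift w, by ext i; simp [hw]⟩

/-- Free covers `F → A → G` and `F' → G` are compared on the free product of `F` and `F'`, which
retracts onto `F'` and maps onto `A`, compatibly with the maps to `G`. -/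
theorem isFinitelyNormallyGenerated_ker_of_surjective [Group.FG A]
    [hG : Group.IsFinitelyPresented G] {a : A →* G} (ha : Function.Surjective a) :
    a.ker.IsFinitelyNormallyGenerated := by
  obtain ⟨n, φ, hφ, hφker⟩ := hG.out
  obtain ⟨α, _, f, hf⟩ := Group.fg_iff_exists_freeGroup_hom_surjective_finite.1 ‹Group.FG A›
  obtain ⟨l, hl⟩ := exists_freeGroup_hom_comp_eq hφ (a.comp f)
  obtain ⟨m, hm⟩ := exists_freeGroup_hom_comp_eq ha φ
  let r := Monoid.Coprod.lift l (MonoidHom.id (FreeGroup (Fin n)))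
  let q := Monoid.Coprod.lift f m
  have hqr : a.comp q = φ.comp r := by
    rw [Monoid.Coprod.comp_lift, Monoid.Coprod.comp_lift, hl, hm, MonoidHom.comp_id]
  have hr : r.comp Monoid.Coprod.inr = MonoidHom.id _ := Monoid.Coprod.lift_comp_inr _ _
  have hq : Function.Surjective q :=
    .of_comp (g := Monoid.Coprod.inl) (by simpa [q, ← MonoidHom.coe_comp] using hf)
  have : Group.FG (Monoid.Coprod (FreeGroup α) (FreeGroup (Fin n))) :=
    fg_of_isFinitelyPresented _
  have hker : (a.comp q).ker.IsFinitelyNormallyGenerated := by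
    rw [hqr, ← MonoidHom.comap_ker]
    have hr_surj : Function.Surjective r := fun x =>
      ⟨Monoid.Coprod.inr x, DFunLike.congr_fun hr x⟩
    exact hφker.comap hr_surj (isFinitelyNormallyGenerated_ker_of_comp_eq_id r _ hr)
  rw [← Subgroup.map_comap_eq_self_of_surjective hq a.ker, MonoidHom.comap_ker]
  exact hker.map hq

theorem IsFinitePresentation.of_surjective [hA : Group.IsFinitelyPresented A]
    [Group.IsFinitelyPresented G] {a : A →* G} (ha : Function.Surjective a) :
    IsFinitePresentation a := by
  have := fg_of_isFinitelyPresented A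
  obtain ⟨S, hS, hSa⟩ := isFinitelyNormallyGenerated_ker_of_surjective ha
  refine ⟨hA, ha, Subgroup.closure S, (Subgroup.fg_iff _).2 ⟨S, rfl, hS⟩, ?_⟩
  rw [Subgroup.normalClosure_closure_eq_normalClosure, hSa]

end FinitelyPresented

/-- A factor set of a group `G` with values in an abelian group `M`, that is, an inhomogeneous
`2`-cocycle for the trivial action of `G` on `M`. Unlike `groupCohomology.IsCocycle₂` it requires no
`SMul` instance, so that the trivial action need not be installed on `M`. -/
def IsFactorSet {G M : Type*} [Group G] [AddCommGroup M] (f : G × G → M) : Prop :=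
  ∀ g h j, f (g * h, j) + f (g, h) = f (h, j) + f (g, h * j)

/-- A trivial factor set, that is, the coboundary of a function `φ` for the trivial action, with the
sign convention of `groupCohomology.coboundaries₂`. -/
def IsTrivialFactorSet {G M : Type*} [Group G] [AddCommGroup M] (f : G × G → M) : Prop :=
  ∃ φ : G → M, ∀ g h, φ h - φ (g * h) + φ g = f (g, h)

namespace IsFactorSet

variable {G M : Type*} [Group G] [AddCommGroup M] {f : G × G → M}

theorem map_one_left (hf : IsFactorSet f) (g : G) : f (1, g) = f (1, 1) := by
  simpa using (hf 1 1 g).symm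

theorem map_one_right (hf : IsFactorSet f) (g : G) : f (g, 1) = f (1, 1) := by
  simpa using hf g 1 1

/-- The central extension of `G` by `M` defined by the factor set `f`, on the underlying set
`M × G`. Since `f` need not be normalized, the unit is `(-f (1, 1), 1)`. -/
@[ext]
structure Extension (hf : IsFactorSet f) where
  fst : M
  snd : G

namespace Extension

variable {hf : IsFactorSet f}

instance : Mul hf.Extension :=
  ⟨fun x y => ⟨x.fst + y.fst + f (x.snd, y.snd), x.snd * y.snd⟩⟩

instance : One hf.Extension := ⟨⟨-f (1, 1), 1⟩⟩

instance : Inv hf.Extension :=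
  ⟨fun x => ⟨-x.fst - f (x.snd⁻¹, x.snd) - f (1, 1), x.snd⁻¹⟩⟩

@[simp] theorem fst_mul (x y : hf.Extension) :
    (x * y).fst = x.fst + y.fst + f (x.snd, y.snd) := rfl

@[simp] theorem snd_mul (x y : hf.Extension) : (x * y).snd = x.snd * y.snd := rfl

@[simp] theorem fst_one : (1 : hf.Extension).fst = -f (1, 1) := rfl

@[simp] theorem snd_one : (1 : hf.Extension).snd = 1 := rfl

@[simp] theorem fst_inv (x : hf.Extension) :
    x⁻¹.fst = -x.fst - f (x.snd⁻¹, x.snd) - f (1, 1) := rfl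

@[simp] theorem snd_inv (x : hf.Extension) : x⁻¹.snd = x.snd⁻¹ := rfl

instance : Group hf.Extension :=
  Group.ofLeftAxioms
    (fun x y z => by
      ext
      · calc
          x.fst + y.fst + f (x.snd, y.snd) + z.fst + f (x.snd * y.snd, z.snd)
          _ = x.fst + y.fst + z.fst + (f (x.snd * y.snd, z.snd) + f (x.snd, y.snd)) := by abel
          _ = x.fst + y.fst + z.fst + (f (y.snd, z.snd) + f (x.snd, y.snd * z.snd)) := by
            rw [hf]
          _ = x.fst + (y.fst + z.fst + f (y.snd, z.snd)) + f (x.snd, y.snd * z.snd) := by abel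
      · exact mul_assoc _ _ _)
    (fun x => by ext <;> simp [hf.map_one_left])
    (fun x => by
      ext
      · simp only [fst_mul, fst_inv, snd_inv, fst_one]
        abel
      · simp)

/-- The inclusion of `M` as a central subgroup of the extension. -/
def inl : Multiplicative M →* hf.Extension :=
  MonoidHom.mk' (fun c => ⟨c.toAdd - f (1, 1), 1⟩) fun c d => by
    ext
    · simp only [toAdd_mul, fst_mul]
      abel
    · simp

@[simp] theorem fst_inl (c : Multiplicative M) :
    (inl c : hf.Extension).fst = c.toAdd - f (1, 1) := rfl

@[simp] theorem snd_inl (c : Multiplicative M) : (inl c : hf.Extension).snd = 1 := rfl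

theorem inl_injective : Function.Injective (inl : Multiplicative M →* hf.Extension) :=
  fun _ _ h => Multiplicative.toAdd.injective (sub_left_injective (congrArg fst h))

theorem mk_zero_mul_mk_zero (g h : G) :
    (⟨0, g⟩ * ⟨0, h⟩ : hf.Extension) = inl (.ofAdd (f (g, h))) * ⟨0, g * h⟩ := by
  ext <;> simp [hf.map_one_left]

theorem exists_lift_of_isTrivialFactorSet {P : Type*} [Group P] (p : P →* G)
    (h : IsTrivialFactorSet (f ∘ Prod.map p p)) :
    ∃ s : P →* hf.Extension, ∀ x, (s x).snd = p x := by
  obtain ⟨φ, hφ⟩ := h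
  refine ⟨MonoidHom.mk' (fun x => ⟨-φ x, p x⟩) fun x y => ?_, fun _ => rfl⟩
  have hxy : φ y - φ (x * y) + φ x = f (p x, p y) := hφ x y
  ext
  · simp only [fst_mul, ← hxy]
    abel
  · simp

end Extension

end IsFactorSet

open scoped commutatorElement

namespace IsFactorSet

variable {G M : Type*} [CommGroup G] [AddCommGroup M] {f : G × G → M}

theorem Extension.commutatorElement_eq_inl {hf : IsFactorSet f} (x y : hf.Extension) :
    ⁅x, y⁆ = inl (.ofAdd (f (x.snd, y.snd) - f (y.snd, x.snd))) := by
  rw [commutatorElement_def, mul_inv_eq_iff_eq_mul, mul_inv_eq_iff_eq_mul]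
  ext
  · simp only [fst_mul, snd_mul, fst_inl, snd_inl, toAdd_ofAdd, one_mul, hf.map_one_left]
    abel
  · simp only [snd_mul, snd_inl, one_mul, mul_comm x.snd]

theorem isTrivialFactorSet_of_symmetric [DivisibleBy M ℤ] (hf : IsFactorSet f)
    (hsymm : ∀ g h, f (g, h) = f (h, g)) : IsTrivialFactorSet f := by
  let _ : CommGroup hf.Extension :=
    { mul_comm := fun x y => commutatorElement_eq_one_iff_mul_comm.1 <| by
        rw [Extension.commutatorElement_eq_inl, hsymm, sub_self, ofAdd_zero, map_one] }
  obtain ⟨ρ, hρ⟩ := (Module.Baer.of_divisible M).extension_property_addMonoidHom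
    (MonoidHom.toAdditiveRight Extension.inl : M →+ Additive hf.Extension)
    Extension.inl_injective (AddMonoidHom.id M)
  let σ (g : G) : M := ρ (.ofMul ⟨0, g⟩)
  refine ⟨σ, fun g h => ?_⟩
  have hσ : σ g + σ h = f (g, h) + σ (g * h) := by
    have hρ_mul := congrArg (ρ ∘ Additive.ofMul) (Extension.mk_zero_mul_mk_zero (hf := hf) g h)
    have hρ_inl : ρ (.ofMul (Extension.inl (.ofAdd (f (g, h))))) = f (g, h) :=
      DFunLike.congr_fun hρ _
    simpa only [Function.comp_apply, ofMul_mul, map_add, hρ_inl] using hρ_mul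
  rw [sub_add_eq_add_sub, add_comm, hσ, add_sub_cancel_right]

end IsFactorSet

theorem map_surfaceRelator {E : Type*} [Group E] {g : ℕ} (q : FreeGroup (Fin g ⊕ Fin g) →* E) :
    q (surfaceRelator g) =
      (List.ofFn fun i => ⁅q (FreeGroup.of (Sum.inl i)), q (FreeGroup.of (Sum.inr i))⁆).prod := by
  simp only [surfaceRelator, map_list_prod, List.map_ofFn, Function.comp_def, map_mul, map_inv,
    commutatorElement_def]

namespace SurfaceGroup

variable {g : ℕ}

/-- The standard generators `a_i` of the surface group. -/
def a (i : Fin g) : SurfaceGroup g := PresentedGroup.of (Sum.inl i)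

/-- The standard generators `b_i` of the surface group. -/
def b (i : Fin g) : SurfaceGroup g := PresentedGroup.of (Sum.inr i)

theorem prod_commutatorElement_map_eq_one {E : Type*} [Group E] (s : SurfaceGroup g →* E) :
    (List.ofFn fun i => ⁅s (a i), s (b i)⁆).prod = 1 := by
  refine (map_surfaceRelator (s.comp (PresentedGroup.mk _))).symm.trans ?_
  rw [MonoidHom.comp_apply, PresentedGroup.one_of_mem (Set.mem_singleton _), map_one]

section CommGroup

variable {G : Type*} [CommGroup G]

/-- The homomorphism from a surface group to an abelian group with prescribed values on the
standard generators. -/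
def toCommGroup (x y : Fin g → G) : SurfaceGroup g →* G :=
  PresentedGroup.toGroup (f := Sum.elim x y) <| by
    rintro _ rfl
    simp [map_surfaceRelator, commutatorElement_def]

@[simp] theorem toCommGroup_a (x y : Fin g → G) (i : Fin g) : toCommGroup x y (a i) = x i :=
  PresentedGroup.toGroup.of _

@[simp] theorem toCommGroup_b (x y : Fin g → G) (i : Fin g) : toCommGroup x y (b i) = y i :=
  PresentedGroup.toGroup.of _

theorem exists_surjective_and_map_zero_eq [Group.FG G] (x y : G) :
    ∃ (n : ℕ) (p : SurfaceGroup (n + 1) →* G), Function.Surjective p ∧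
      p (a 0) = x ∧ p (b 0) = y ∧ ∀ i : Fin n, p (b i.succ) = 1 := by
  obtain ⟨S, hS, hSfin⟩ := Group.fg_iff.1 ‹Group.FG G›
  obtain ⟨n, t, -, rfl⟩ := hSfin.fin_param
  let p := toCommGroup (Fin.cons x t : Fin (n + 1) → G) (Fin.cons y 1)
  refine ⟨n, p, ?_, by simp [p], by simp [p], by simp [p]⟩
  rw [← MonoidHom.range_eq_top, eq_top_iff, ← hS, Subgroup.closure_le]
  rintro _ ⟨i, rfl⟩
  exact ⟨a i.succ, by simp [p]⟩

/-- The sum is the value of the pulled back class on the fundamental class of the surface. -/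
theorem sum_sub_swap_eq_zero_of_isTrivialFactorSet {M : Type*} [AddCommGroup M] {f : G × G → M}
    (hf : IsFactorSet f) (p : SurfaceGroup g →* G) (h : IsTrivialFactorSet (f ∘ Prod.map p p)) :
    ∑ i, (f (p (a i), p (b i)) - f (p (b i), p (a i))) = 0 := by
  obtain ⟨s, hs⟩ := IsFactorSet.Extension.exists_lift_of_isTrivialFactorSet (hf := hf) p h
  have hprod := prod_commutatorElement_map_eq_one s
  simp only [IsFactorSet.Extension.commutatorElement_eq_inl, hs] at hprod
  apply Multiplicative.ofAdd.injective
  apply IsFactorSet.Extension.inl_injective (hf := hf)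
  rw [ofAdd_sum, ← List.prod_ofFn, map_list_prod, List.map_ofFn, ofAdd_zero, map_one, ← hprod]
  rfl

end CommGroup

end SurfaceGroup

section GroupCohomology

universe u

open groupCohomology

variable {k G P M : Type u} [CommRing k] [Group G] [Group P] [AddCommGroup M] [Module k M]

theorem isFactorSet_cocycles₂ (f : cocycles₂ (Rep.trivial k G M)) : IsFactorSet (M := M) f :=
  fun g h j => by simpa using (mem_cocycles₂_iff f).1 f.2 g h j

theorem H2π_eq_zero_iff_isTrivialFactorSet (f : cocycles₂ (Rep.trivial k G M)) :
    H2π _ f = 0 ↔ IsTrivialFactorSet (M := M) f :=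
  (H2π_eq_zero_iff f).trans <| exists_congr fun _ => funext_iff.trans Prod.forall

theorem map_H2π_eq_zero_iff_isTrivialFactorSet (p : P →* G) (f : cocycles₂ (Rep.trivial k G M)) :
    groupCohomology.map (A := Rep.trivial k G M) (B := Rep.trivial k P M) p
        (𝟙 (Rep.trivial k P M)) 2 (H2π _ f) = 0 ↔
      IsTrivialFactorSet (M := M) (f ∘ Prod.map p p) :=
  (Eq.congr_left (H2π_comp_map_apply p _ f)).trans (H2π_eq_zero_iff_isTrivialFactorSet _)

end GroupCohomology

theorem mainTheorem12_general {k Γ M : Type} [CommRing k] [CommGroup Γ]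
    [Group.IsFinitelyPresented Γ] [AddCommGroup M] [Module k M] [DivisibleBy M ℤ]
    {c : groupCohomology (Rep.trivial k Γ M) 2} (hc : c ≠ 0) :
    ∃ (g : ℕ) (p : SurfaceGroup g →* Γ), IsFinitePresentation p ∧
      groupCohomology.map (A := Rep.trivial k Γ M) (B := Rep.trivial k (SurfaceGroup g) M) p
        (𝟙 (Rep.trivial k (SurfaceGroup g) M)) 2 c ≠ 0 := by
  induction c using groupCohomology.H2_induction_on with | h f =>
  have hf := isFactorSet_cocycles₂ f
  obtain ⟨x, y, hxy⟩ : ∃ x y, f (x, y) ≠ f (y, x) := by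
    by_contra! hsymm
    exact hc ((H2π_eq_zero_iff_isTrivialFactorSet f).2 (hf.isTrivialFactorSet_of_symmetric hsymm))
  have := fg_of_isFinitelyPresented Γ
  obtain ⟨n, p, hp, hx, hy, hb⟩ := SurfaceGroup.exists_surjective_and_map_zero_eq x y
  refine ⟨n + 1, p, .of_surjective hp, fun hzero => hxy (sub_eq_zero.1 ?_)⟩
  have hsum := SurfaceGroup.sum_sub_swap_eq_zero_of_isTrivialFactorSet hf p
    ((map_H2π_eq_zero_iff_isTrivialFactorSet p f).1 hzero)
  simpa [Fin.sum_univ_succ, hx, hy, hb, hf.map_one_left, hf.map_one_right] using hsum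

theorem mainTheorem12 (Γ : Type) [CommGroup Γ] (hΓ : Group.IsFinitelyPresented Γ)
    (hH : Nontrivial (realCohomology Γ 2)) :
    ∃ (g : ℕ) (p : SurfaceGroup g →* Γ),
      IsFinitePresentation p ∧ realCohomologyMap p 2 ≠ 0 := by
  obtain ⟨c, hc⟩ := exists_ne (0 : realCohomology Γ 2)
  obtain ⟨g, p, hp, hpc⟩ := mainTheorem12_general hc
  exact ⟨g, p, hp, fun hzero => hpc (congrArg (fun F => F.hom c) hzero)⟩
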